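/- Let $(\Omega,\mathcal F,P)$ be a probability space, let $L^\infty_+$ be the set of essentially bounded random variables $X$ with $X\ge 0$ $P$-a.s., and let $\mathbf P$ be the set of probability measures $Q$ on $(\Omega,\mathcal F)$ with $Q\ll P$. Let $\Phi\colon[0,+\infty)\to\mathbb R\cup\{\pm\infty\}$ be a convex Orlicz function, that is, a convex, nondecreasing and left-continuous function with $\Phi(x)>-\infty$ for $x>0$, $\Phi(x)\le 1$ for $x\le 1$ and $\Phi(x)>1$ for $x>1$. Let $$H_\Phi(X)=\inf\{k>0 \mid \mathbb E[\Phi(X/k)]\le 1\},\qquad X\in L^\infty_+,$$ be the Orlicz premium, let $\Psi(y)=\sup_{x\ge 0}\{xy-\Phi(x)\}$ be the convex conjugate of $\Phi$, and for $Q\in\mathbf P$ put $$\beta(Q)=\Bigl(\inf_{\lambda>0}\frac1\lambda\,\mathbb E\Bigl[1+\Psi\Bigl(\lambda\frac{\mathrm dQ}{\mathrm dP}\Bigr)\Bigr]\Bigr)^{-1},\qquad \frac1{+\infty}:=0 .$$ Then $\beta(Q)\in[0,1]$ for every $Q\in\mathbf P$, and $$H_\Phi(X)=\sup_{Q\in\mathbf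 P}\{\beta(Q)\,\mathbb E_Q[X]\}\qquad\text{for every } X\in L^\infty_+ .$$ If moreover $\Phi(0)<1$, then for every $Q\in\mathbf P$ $$\beta(Q)=\Bigl[\sup\{\mathbb E_Q[X] \mid X\in L^\infty_+,\ H_\Phi(X)\le 1\}\Bigr]^{-1}.$$ -/

import Mathlib

open MeasureTheory Set
open scoped ENNReal NNReal

noncomputable section

namespace OrliczDual

/-- An Orlicz function `Φ : [0, ∞) → ℝ ∪ {±∞}` (not necessarily convex). -/
structure IsOrliczFunction (Φ : ℝ≥0 → EReal) : Prop where
  bot_lt : ∀ x : ℝ≥0, 0 < x → ⊥ < Φ x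
  le_one : ∀ x : ℝ≥0, x ≤ 1 → Φ x ≤ 1
  one_lt : ∀ x : ℝ≥0, 1 < x → 1 < Φ x
  mono : Monotone Φ
  left_cont : ∀ x : ℝ≥0, ContinuousWithinAt Φ (Iic x) x

/-- Convexity of an extended-real-valued function on `[0, ∞)`: its epigraph is convex. -/
def IsConvexFn (Φ : ℝ≥0 → EReal) : Prop :=
  Convex ℝ≥0 {p : ℝ≥0 × ℝ | Φ p.1 ≤ (p.2 : EReal)}

/-- The convex conjugate `Ψ(y) = sup_{x ≥ 0} (x y - Φ(x))`. -/
def convexConjugate (Φ : ℝ≥0 → EReal) (y : ℝ) : EReal :=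
  ⨆ x : ℝ≥0, ((((x : ℝ) * y : ℝ) : EReal) - Φ x)

variable {Ω : Type*} [MeasurableSpace Ω]

/-- Expectation of an extended-real-valued random variable, `E[f⁺] - E[f⁻]`. It is used below for
functions that are bounded from below, for which it is a well-defined element of `(-∞, +∞]`. -/
def eexpect (P : Measure Ω) (f : Ω → EReal) : EReal :=
  ((∫⁻ ω, (f ω).toENNReal ∂P : ℝ≥0∞) : EReal) - ((∫⁻ ω, (-f ω).toENNReal ∂P : ℝ≥0∞) : EReal)

/-- `L^∞_+`: the essentially bounded random variables that are a.s. nonnegative. -/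
def linftyPos (P : Measure Ω) : Set (Ω → ℝ) :=
  {X | MemLp X ∞ P ∧ 0 ≤ᵐ[P] X}

open Classical in
/-- The Orlicz premium `H_Φ(X) = inf {k > 0 | E[Φ(X / k)] ≤ 1}`, set to `0` when `P(X = 0) > 0`
and `Φ(0) = -∞`. -/
def orliczPremium (P : Measure Ω) (Φ : ℝ≥0 → EReal) (X : Ω → ℝ) : ℝ :=
  if 0 < P {ω | X ω = 0} ∧ Φ 0 = ⊥ then 0
  else sInf {k : ℝ | 0 < k ∧ eexpect P (fun ω => Φ (X ω / k).toNNReal) ≤ 1}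

/-- The probability measures that are absolutely continuous with respect to `P`. -/
def absContProb (P : Measure Ω) : Set (Measure Ω) :=
  {Q | IsProbabilityMeasure Q ∧ Q ≪ P}

/-- The multiplicative acceptance set `{X ∈ L^∞_+ | ρ(X) ≤ 1}` of `ρ`. -/
def acceptanceSet (P : Measure Ω) (ρ : (Ω → ℝ) → ℝ) : Set (Ω → ℝ) :=
  {X | X ∈ linftyPos P ∧ ρ X ≤ 1}

/-- The penalty `[sup_{X ∈ B_ρ} E_Q[X]]⁻¹` of the dual representation of a convex return risk
measure `ρ`, with `1 / ∞ = 0`. -/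
def riskPenalty (P : Measure Ω) (ρ : (Ω → ℝ) → ℝ) (Q : Measure Ω) : EReal :=
  (⨆ X ∈ acceptanceSet P ρ, ((∫ ω, X ω ∂Q : ℝ) : EReal))⁻¹

/-- The penalty `(inf_{t > 0} t⁻¹ E[1 + Ψ(t dQ/dP)])⁻¹`, with `1 / ∞ = 0`. -/
def orliczPenalty (P : Measure Ω) (Φ : ℝ≥0 → EReal) (Q : Measure Ω) : EReal :=
  (⨅ t : {t : ℝ // 0 < t}, (((t : ℝ)⁻¹ : ℝ) : EReal) *
    eexpect P (fun ω => 1 + convexConjugate Φ ((t : ℝ) * (Q.rnDeriv P ω).toReal)))⁻¹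

end OrliczDual

end

open MeasureTheory Set
open scoped ENNReal NNReal

/-! Write `c(Q)` for the infimum whose inverse is `β(Q)`, and `Z = dQ/dP`. Young's inequality `xy ≤
Φ(x) + Ψ(y)` at `x = 1`, `y = tZ` gives `c(Q) ≥ 1`; at `x = X/k` it gives `E_Q[X]/k ≤ c(Q)` whenever
`E[Φ(X/k)] ≤ 1` (`integral_div_le_penaltyInf`).

Conversely, if `E[Φ(X/k)] > 1`, Fenchel–Moreau writes `Φ` as a countable supremum of affine
functions `ax - b` with `Ψ(a) ≤ b`. A finitely valued measurable selection `W` of slopes and `B` of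
intercepts keeps `E[W X/k - B] > 1`. Normalising `W` to a density and taking `t = E[W]` yields `c(Q)
≤ E_Q[X]/k` (`exists_penaltyInf_le`), so no compactness argument is needed.

The last formula is Lagrangian duality for maximising `E_Q[X]` under `E[Φ(X)] ≤ 1`: `Φ(0) < 1` makes
`X = 0` a Slater point, the multiplier is in essence `1/t`, and the same selection moves the
supremum over `X` inside the expectation (`penaltyInf_le_of_bound`). -/

namespace OrliczDual

/-! ### Multipliers, expectations and measurable selection. -/

section

/-- Lagrange multiplier for a convex set of pairs (constraint value, objective value). -/
lemma exists_multiplier {A : Set (ℝ × ℝ)} (hA : Convex ℝ A) {t₀ S : ℝ}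
    (hS : ∀ p ∈ A, p.1 ≤ t₀ → p.2 ≤ S) {p₀ : ℝ × ℝ} (hp₀ : p₀ ∈ A) (hlt : p₀.1 < t₀) :
    ∃ l : ℝ, 0 ≤ l ∧ ∀ p ∈ A, p.2 ≤ S + l * (p.1 - t₀) := by
  -- The chord from `p` to `q` meets the vertical line at `t₀` at height at most `S`, so slopes seen
  -- from `(t₀, S)` to the right never exceed those to the left.
  have key : ∀ p ∈ A, ∀ q ∈ A, p.1 < t₀ → t₀ < q.1 →
      (q.2 - S) / (q.1 - t₀) ≤ (S - p.2) / (t₀ - p.1) := by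
    intro p hp q hq hpt hqt
    have hd : 0 < q.1 - p.1 := by linarith
    have hm := hA hp hq (a := (q.1 - t₀) / (q.1 - p.1)) (b := (t₀ - p.1) / (q.1 - p.1))
      (div_nonneg (by linarith) hd.le) (div_nonneg (by linarith) hd.le)
      (by field_simp; ring)
    have h2 := hS _ hm (by
      simp only [Prod.fst_add, Prod.smul_fst, smul_eq_mul]
      apply le_of_eq; field_simp; ring)
    simp only [Prod.snd_add, Prod.smul_snd, smul_eq_mul] at h2
    rw [div_mul_eq_mul_div, div_mul_eq_mul_div, ← add_div, div_le_iff₀ hd] at h2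
    rw [div_le_div_iff₀ (by linarith) (by linarith)]
    nlinarith
  -- The multiplier is the supremum of the right slopes; inserting 0 makes it nonnegative and covers
  -- the case of no point to the right.
  let L : Set ℝ := insert 0 ((fun q : ℝ × ℝ => (q.2 - S) / (q.1 - t₀)) '' {q ∈ A | t₀ < q.1})
  have hub : ∀ p ∈ A, p.1 < t₀ → (S - p.2) / (t₀ - p.1) ∈ upperBounds L := by
    intro p hp hpt x hx
    rcases hx with rfl | ⟨q, ⟨hq, hqt⟩, rfl⟩
    · exact div_nonneg (by linarith [hS p hp hpt.le]) (by linarith)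
    · exact key p hp q hq hpt hqt
  have hbdd : BddAbove L := ⟨_, hub p₀ hp₀ hlt⟩
  refine ⟨sSup L, le_csSup hbdd (mem_insert _ _), fun p hp => ?_⟩
  rcases lt_trichotomy p.1 t₀ with h | h | h
  · have := csSup_le (insert_nonempty _ _) (hub p hp h)
    rw [le_div_iff₀ (by linarith)] at this
    linarith
  · have := hS p hp h.le
    rw [h]; linarith
  · have := le_csSup hbdd (mem_insert_of_mem 0 (mem_image_of_mem _
      (show p ∈ {q ∈ A | t₀ < q.1} from ⟨hp, h⟩)))
    rw [div_le_iff₀ (by linarith)] at this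
    linarith

/-- The affine functions parametrised by a set of pairs have the same supremum as those of a
sequence in it, which may be started at a prescribed pair. -/
lemma exists_seq_affine (T : Set (ℝ≥0 × ℝ)) {p₀ : ℝ≥0 × ℝ} (hp₀ : p₀ ∈ T) :
    ∃ p : ℕ → ℝ≥0 × ℝ, p 0 = p₀ ∧ (∀ n, p n ∈ T) ∧ ∀ y : ℝ, ∀ q ∈ T,
      (((q.1 : ℝ) * y - q.2 : ℝ) : EReal) ≤ ⨆ n, ((((p n).1 : ℝ) * y - (p n).2 : ℝ) : EReal) := by
  obtain ⟨D, hDc, hD⟩ := TopologicalSpace.exists_countable_dense T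
  have hne : D.Nonempty := by
    have : Nonempty T := ⟨⟨p₀, hp₀⟩⟩
    exact hD.nonempty
  obtain ⟨d, rfl⟩ := hDc.exists_eq_range hne
  refine ⟨fun n => Nat.casesOn n p₀ (fun k => (d k : ℝ≥0 × ℝ)), rfl, ?_, ?_⟩
  · rintro (_ | n)
    · exact hp₀
    · exact (d n).2
  · intro y q hq
    let f : T → EReal := fun q => (((q.1.1 : ℝ) * y - q.1.2 : ℝ) : EReal)
    have hf : Continuous f := by
      refine continuous_coe_real_ereal.comp ?_
      fun_prop
    have hcl : IsClosed {q : T | f q ≤ ⨆ n, f (d n)} := isClosed_le hf continuous_const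
    have : ∀ q : T, f q ≤ ⨆ n, f (d n) := by
      intro q
      have := closure_minimal (s := range d)
        (by rintro _ ⟨n, rfl⟩; exact le_iSup (fun n => f (d n)) n) hcl
      exact this (hD q)
    refine (this ⟨q, hq⟩).trans (iSup_le fun n => ?_)
    exact le_iSup_of_le (n + 1) le_rfl

variable {Ω : Type*} [MeasurableSpace Ω]

lemma coe_integral_eq {P : Measure Ω} {b : Ω → ℝ} (hb : Integrable b P) :
    ((∫ ω, b ω ∂P : ℝ) : EReal) =
      ((∫⁻ ω, ENNReal.ofReal (b ω) ∂P : ℝ≥0∞) : EReal)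
        - ((∫⁻ ω, ENNReal.ofReal (-b ω) ∂P : ℝ≥0∞) : EReal) := by
  rw [integral_eq_lintegral_pos_part_sub_lintegral_neg_part hb, EReal.coe_sub,
    EReal.coe_ennreal_toReal hb.lintegral_lt_top.ne,
    EReal.coe_ennreal_toReal (Integrable.lintegral_lt_top (f := fun ω => -b ω) hb.neg).ne]

/-- Both parts of `f` compare as lower integrals, so `f` need not be measurable; measurability of
`Ψ` is therefore never required. -/
lemma eexpect_le_integral {P : Measure Ω} {f : Ω → EReal} {b : Ω → ℝ} (hb : Integrable b P)
    (h : ∀ᵐ ω ∂P, f ω ≤ b ω) : eexpect P f ≤ ((∫ ω, b ω ∂P : ℝ) : EReal) := by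
  rw [coe_integral_eq hb, eexpect]
  refine EReal.sub_le_sub ?_ ?_
  · exact_mod_cast lintegral_mono_ae (h.mono fun ω hω => by
      simpa using EReal.toENNReal_le_toENNReal hω)
  · exact_mod_cast lintegral_mono_ae (h.mono fun ω hω => by
      simpa using EReal.toENNReal_le_toENNReal (EReal.neg_le_neg_iff.2 hω))

lemma integral_le_eexpect {P : Measure Ω} {f : Ω → EReal} {b : Ω → ℝ} (hb : Integrable b P)
    (h : ∀ᵐ ω ∂P, (b ω : EReal) ≤ f ω) : ((∫ ω, b ω ∂P : ℝ) : EReal) ≤ eexpect P f := by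
  rw [coe_integral_eq hb, eexpect]
  refine EReal.sub_le_sub ?_ ?_
  · exact_mod_cast lintegral_mono_ae (h.mono fun ω hω => by
      simpa using EReal.toENNReal_le_toENNReal hω)
  · exact_mod_cast lintegral_mono_ae (h.mono fun ω hω => by
      simpa using EReal.toENNReal_le_toENNReal (EReal.neg_le_neg_iff.2 hω))

lemma eexpect_congr {P : Measure Ω} {f g : Ω → EReal} (h : f =ᵐ[P] g) :
    eexpect P f = eexpect P g := by
  have h1 := lintegral_congr_ae (h.fun_comp EReal.toENNReal)
  have h2 := lintegral_congr_ae (h.fun_comp fun x => (-x).toENNReal)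
  simp only [Function.comp_apply] at h1 h2
  rw [eexpect, eexpect, h1, h2]

/-- A function that is bounded from below and has finite expectation is dominated by an integrable
function with no larger expectation. -/
lemma exists_integrable_of_eexpect_le {P : Measure Ω} [IsProbabilityMeasure P] {f : Ω → EReal}
    (hf : AEMeasurable f P) {m c : ℝ} (hm : ∀ ω, (m : EReal) ≤ f ω) (hc : eexpect P f ≤ c) :
    ∃ b : Ω → ℝ, Integrable b P ∧ (∀ᵐ ω ∂P, f ω ≤ b ω) ∧ ∫ ω, b ω ∂P ≤ c := by
  have hn : ∫⁻ ω, (-f ω).toENNReal ∂P ≠ ⊤ := by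
    refine ne_top_of_le_ne_top (b := ENNReal.ofReal (-m)) ENNReal.ofReal_ne_top ?_
    calc ∫⁻ ω, (-f ω).toENNReal ∂P ≤ ∫⁻ ω, ENNReal.ofReal (-m) ∂P :=
          lintegral_mono fun ω => by
            simpa using EReal.toENNReal_le_toENNReal (EReal.neg_le_neg_iff.2 (hm ω))
      _ = _ := by simp
  have hp : ∫⁻ ω, (f ω).toENNReal ∂P ≠ ⊤ := by
    intro h
    rw [eexpect, h, ← EReal.coe_ennreal_toReal hn] at hc
    simp at hc
  have hpm : AEMeasurable (fun ω => (f ω).toENNReal) P :=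
    measurable_ereal_toENNReal.comp_aemeasurable hf
  have hnm : AEMeasurable (fun ω => (-f ω).toENNReal) P :=
    (measurable_ereal_toENNReal.comp measurable_neg).comp_aemeasurable hf
  have i1 := integrable_toReal_of_lintegral_ne_top hpm hp
  have i2 := integrable_toReal_of_lintegral_ne_top hnm hn
  have hfin : ∀ᵐ ω ∂P, (f ω).toENNReal < ⊤ := ae_lt_top' hpm hp
  refine ⟨fun ω => (f ω).toENNReal.toReal - (-f ω).toENNReal.toReal, i1.sub i2, ?_, ?_⟩
  · filter_upwards [hfin] with ω hω
    have h1 : f ω ≠ ⊤ := by rintro h; simp [h] at hω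
    have h2 : f ω ≠ ⊥ := fun h => by simpa [h] using hm ω
    lift f ω to ℝ using ⟨h1, h2⟩ with x
    rw [← EReal.coe_neg, EReal.toENNReal_of_ne_top (EReal.coe_ne_top _),
      EReal.toENNReal_of_ne_top (EReal.coe_ne_top _)]
    simp only [EReal.toReal_coe]
    rw [EReal.coe_le_coe_iff]
    rcases le_total 0 x with h | h
    · rw [ENNReal.toReal_ofReal h, ENNReal.ofReal_of_nonpos (by linarith)]; simp
    · rw [ENNReal.toReal_ofReal (r := -x) (by linarith), ENNReal.ofReal_of_nonpos h]; simp
  · rw [integral_sub i1 i2, integral_toReal hpm hfin, integral_toReal hnm (ae_lt_top' hnm hn)]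
    rw [← EReal.coe_le_coe_iff, EReal.coe_sub, EReal.coe_ennreal_toReal hp, EReal.coe_ennreal_toReal hn]
    exact hc

/-- Near-maximisers of a supremum of affine functions can be selected measurably, with finitely
many values, without losing expectation. -/
lemma exists_selection {P : Measure Ω} [IsProbabilityMeasure P] {Y : Ω → ℝ} (hY : Integrable Y P)
    (hYm : Measurable Y) {a b : ℕ → ℝ} (ha : a 0 = 0) {F : Ω → EReal}
    (hF : ∀ ω, F ω ≤ ⨆ n, ((a n * Y ω - b n : ℝ) : EReal)) {c : ℝ} (hc : c < eexpect P F) :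
    ∃ N : Ω → ℕ, Measurable N ∧ (∃ M, ∀ ω, N ω ≤ M) ∧ c < ∫ ω, (a (N ω) * Y ω - b (N ω)) ∂P := by
  let g : ℕ → Ω → ℝ := fun n ω => a n * Y ω - b n
  have hg : ∀ n, Measurable (g n) := fun n => (hYm.const_mul _).sub_const _
  -- Running argmax: `N n ω` is the first index maximising `g 0 ω, …, g n ω`.
  let N : ℕ → Ω → ℕ := fun n => Nat.rec (fun _ => 0)
    (fun k f ω => if g (f ω) ω < g (k + 1) ω then k + 1 else f ω) n
  have hNs : ∀ n ω, N (n + 1) ω = if g (N n ω) ω < g (n + 1) ω then n + 1 else N n ω :=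
    fun n ω => rfl
  have hcomp : ∀ {f : Ω → ℕ}, Measurable f → Measurable fun ω => g (f ω) ω := by
    intro f hf
    have h1 : Measurable fun q : ℕ × Ω => g q.1 q.2 := measurable_from_prod_countable_right hg
    exact h1.comp (hf.prodMk measurable_id)
  have hN : ∀ n, Measurable (N n) := by
    intro n
    induction n with
    | zero => exact measurable_const
    | succ n ih =>
      exact Measurable.ite (measurableSet_lt (hcomp ih) (hg _)) measurable_const ih
  have hNle : ∀ n ω, N n ω ≤ n := by
    intro n ω
    induction n with
    | zero => exact le_rfl
    | succ n ih => rw [hNs]; split_ifs <;> omega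
  have hmono : ∀ ω, Monotone fun n => g (N n ω) ω := by
    intro ω
    refine monotone_nat_of_le_succ fun n => ?_
    rw [hNs]; split_ifs with h
    · exact h.le
    · exact le_rfl
  have hle : ∀ n ω, g n ω ≤ g (N n ω) ω := by
    intro n ω
    cases n with
    | zero => exact le_rfl
    | succ n =>
      rw [hNs]; split_ifs with h
      · exact le_rfl
      · exact not_lt.1 h
  -- Since `a 0 = 0`, the running maxima stay above the constant `-b 0`, which is what monotone
  -- convergence needs.
  have hbase : ∀ n ω, 0 ≤ g (N n ω) ω + b 0 := by
    intro n ω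
    have h1 : g (N 0 ω) ω ≤ g (N n ω) ω := hmono ω (Nat.zero_le n)
    have h2 : g (N 0 ω) ω = - b 0 := by simp [N, g, ha]
    linarith
  have hint : ∀ n, Integrable (fun ω => g (N n ω) ω) P := by
    intro n
    have hdom : Integrable (fun ω => ∑ k ∈ Finset.range (n + 1), |g k ω|) P :=
      integrable_finsetSum _ fun k _ => ((hY.const_mul _).sub (integrable_const _)).abs
    refine hdom.mono' (hcomp (hN n)).aestronglyMeasurable (ae_of_all _ fun ω => ?_)
    rw [Real.norm_eq_abs]
    exact Finset.single_le_sum (f := fun k => |g k ω|) (fun k _ => abs_nonneg _)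
      (Finset.mem_range.2 (Nat.lt_succ_of_le (hNle n ω)))
  by_contra hcon
  push Not at hcon
  have hbd : ∀ n, ∫ ω, g (N n ω) ω ∂P ≤ c := fun n => hcon (N n) (hN n) ⟨n, hNle n⟩
  let u : ℕ → Ω → ℝ≥0∞ := fun n ω => ENNReal.ofReal (g (N n ω) ω + b 0)
  have hum : ∀ n, Measurable (u n) := fun n => ((hcomp (hN n)).add_const _).ennreal_ofReal
  let v : Ω → ℝ≥0∞ := fun ω => ⨆ n, u n ω
  have hvm : Measurable v := Measurable.iSup hum
  have hv : ∫⁻ ω, v ω ∂P ≤ ENNReal.ofReal (c + b 0) := by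
    rw [lintegral_iSup hum (fun i j hij ω => ENNReal.ofReal_le_ofReal (by
      have := hmono ω hij
      simp only at this
      linarith))]
    refine iSup_le fun n => ?_
    have hn : Integrable (fun ω => g (N n ω) ω + b 0) P := (hint n).add (integrable_const _)
    rw [← ofReal_integral_eq_lintegral_ofReal hn
      (ae_of_all _ fun ω => hbase n ω)]
    refine ENNReal.ofReal_le_ofReal ?_
    rw [integral_add (hint n) (integrable_const _)]
    simpa using hbd n
  have hvt : ∫⁻ ω, v ω ∂P ≠ ⊤ := ne_top_of_le_ne_top ENNReal.ofReal_ne_top hv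
  have hi := integrable_toReal_of_lintegral_ne_top hvm.aemeasurable hvt
  have hfin := ae_lt_top hvm hvt
  have h1 : eexpect P F ≤ ((∫ ω, ((v ω).toReal - b 0) ∂P : ℝ) : EReal) := by
    refine eexpect_le_integral (hi.sub (integrable_const _)) ?_
    filter_upwards [hfin] with ω hω
    refine (hF ω).trans (iSup_le fun n => ?_)
    rw [EReal.coe_le_coe_iff]
    have h2 : g n ω + b 0 ≤ (v ω).toReal := by
      rw [← ENNReal.ofReal_le_iff_le_toReal hω.ne]
      exact (ENNReal.ofReal_le_ofReal (by linarith [hle n ω])).trans (le_iSup (fun n => u n ω) n)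
    simp only [g] at h2
    linarith
  have h2 : ∫ ω, ((v ω).toReal - b 0) ∂P ≤ c := by
    rw [integral_sub hi (integrable_const _), integral_toReal hvm.aemeasurable hfin]
    have h3 : 0 ≤ c + b 0 := by
      have := hbd 0
      have h4 := integral_nonneg (μ := P) (f := fun ω => g (N 0 ω) ω + b 0) (fun ω => hbase 0 ω)
      rw [integral_add (hint 0) (integrable_const _)] at h4
      simp at h4
      linarith
    have h5 := ENNReal.toReal_mono ENNReal.ofReal_ne_top hv
    rw [ENNReal.toReal_ofReal h3] at h5
    simp
    linarith
  exact absurd (h1.trans (EReal.coe_le_coe_iff.2 h2)) (not_le.2 hc)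

end

/-! ### Convex analysis of `Φ` and its conjugate. -/

section

variable {Φ : ℝ≥0 → EReal}

lemma IsConvexFn.combo_le (h : IsConvexFn Φ) {x y s t a b : ℝ} (hx : 0 ≤ x) (hy : 0 ≤ y)
    (hxs : Φ x.toNNReal ≤ s) (hyt : Φ y.toNNReal ≤ t) (ha : 0 ≤ a) (hb : 0 ≤ b) (hab : a + b = 1) :
    Φ (a * x + b * y).toNNReal ≤ ((a * s + b * t : ℝ) : EReal) := by
  lift x to ℝ≥0 using hx
  lift y to ℝ≥0 using hy
  lift a to ℝ≥0 using ha
  lift b to ℝ≥0 using hb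
  simp only [Real.toNNReal_coe] at hxs hyt
  have := h (x := (x, s)) hxs (y := (y, t)) hyt zero_le zero_le (by exact_mod_cast hab)
  have h2 : ((a : ℝ) * x + b * y).toNNReal = a * x + b * y := by
    rw [← NNReal.coe_mul, ← NNReal.coe_mul, ← NNReal.coe_add, Real.toNNReal_coe]
  rw [h2]
  exact this

/-- If `Φ(0) = -∞`, chords from arbitrarily low points above 0 would force `Φ(1/2) = -∞`. Hence the
exceptional branch of the premium never occurs. -/
lemma IsOrliczFunction.exists_zero_eq (hΦ : IsOrliczFunction Φ) (h : IsConvexFn Φ) :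
    ∃ r : ℝ, Φ 0 = r ∧ r ≤ 1 := by
  have h1 : Φ 0 ≤ 1 := hΦ.le_one 0 zero_le_one
  have hbot : Φ 0 ≠ ⊥ := by
    intro h0
    have hhb : Φ (1 / 2 : ℝ).toNNReal ≠ ⊥ := (hΦ.bot_lt _ (by simp)).ne'
    have hht : Φ (1 / 2 : ℝ).toNNReal ≠ ⊤ :=
      ((hΦ.le_one _ (by rw [Real.toNNReal_le_one]; norm_num)).trans_lt (EReal.coe_lt_top 1)).ne
    have := h.combo_le (x := 1) (y := 0) (s := 1)
      (t := 2 * (Φ (1 / 2 : ℝ).toNNReal).toReal - 2) (a := 1 / 2) (b := 1 / 2)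
      zero_le_one le_rfl (by simpa using hΦ.le_one 1 le_rfl) (by simp [h0])
      (by norm_num) (by norm_num) (by norm_num)
    have hr := EReal.coe_toReal hht hhb
    generalize (Φ (1 / 2 : ℝ).toNNReal).toReal = r at this hr
    rw [mul_one, mul_zero, add_zero, ← hr, EReal.coe_le_coe_iff] at this
    linarith
  have htop : Φ 0 ≠ ⊤ := (h1.trans_lt (EReal.coe_lt_top 1)).ne
  lift Φ 0 to ℝ using ⟨htop, hbot⟩ with r
  exact ⟨r, rfl, by exact_mod_cast h1⟩

lemma le_convexConjugate {x : ℝ≥0} {s : ℝ} (h : Φ x ≤ s) (y : ℝ) :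
    ((x * y - s : ℝ) : EReal) ≤ convexConjugate Φ y := by
  refine le_trans ?_ (le_iSup _ x)
  rw [EReal.coe_sub]
  exact EReal.sub_le_sub le_rfl h

lemma convexConjugate_le {y : ℝ} {c : EReal} (hbot : ∀ x, Φ x ≠ ⊥)
    (h : ∀ (x : ℝ≥0) (s : ℝ), Φ x = s → ((x * y - s : ℝ) : EReal) ≤ c) :
    convexConjugate Φ y ≤ c := by
  refine iSup_le fun x => ?_
  have hb := hbot x
  have hx := h x
  generalize Φ x = z at hb hx
  induction z with
  | bot => exact absurd rfl hb
  | top => simp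
  | coe s => simpa using hx s rfl

lemma IsOrliczFunction.ne_bot (hΦ : IsOrliczFunction Φ) (h : IsConvexFn Φ) (x : ℝ≥0) :
    Φ x ≠ ⊥ := by
  obtain ⟨r, hr, -⟩ := hΦ.exists_zero_eq h
  have h1 : Φ 0 ≤ Φ x := hΦ.mono zero_le
  rintro h2
  simp [h2, hr] at h1

/-- Fenchel–Moreau: `Φ` is approximated at every point by its affine minorants. -/
lemma IsOrliczFunction.exists_affine_minorant (hΦ : IsOrliczFunction Φ) (h : IsConvexFn Φ)
    {x₀ : ℝ≥0} {r : ℝ} (hr : (r : EReal) < Φ x₀) :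
    ∃ (a : ℝ≥0) (b : ℝ), convexConjugate Φ a ≤ b ∧ r ≤ a * x₀ - b := by
  obtain ⟨z, hz, hz1⟩ := hΦ.exists_zero_eq h
  have hzle : ∀ (x : ℝ≥0) (s : ℝ), Φ x = s → z ≤ s := by
    intro x s hs
    have : Φ 0 ≤ Φ x := hΦ.mono zero_le
    rw [hz, hs] at this
    exact_mod_cast this
  rcases le_or_gt r z with hrz | hrz
  · refine ⟨0, -r, convexConjugate_le (hΦ.ne_bot h) fun x s hs => ?_, by simp⟩
    rw [EReal.coe_le_coe_iff]
    have := hzle x s hs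
    simp; linarith
  have hx₀ : 0 < x₀ := by
    rw [pos_iff_ne_zero]
    rintro rfl
    rw [hz, EReal.coe_lt_coe_iff] at hr
    linarith
  obtain ⟨x₁, hx₁, hx₁r⟩ : ∃ x₁ < x₀, (r : EReal) < Φ x₁ := by
    have hne : (nhdsWithin x₀ (Iio x₀)).NeBot := nhdsLT_neBot_of_exists_lt ⟨0, hx₀⟩
    have h1 : ∀ᶠ x in nhdsWithin x₀ (Iio x₀), (r : EReal) < Φ x :=
      ((hΦ.left_cont x₀).mono Iio_subset_Iic_self).eventually (lt_mem_nhds hr)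
    obtain ⟨x, hx, hx'⟩ := (h1.and self_mem_nhdsWithin).exists
    exact ⟨x, hx', hx⟩
  -- The epigraph with its axes exchanged: the argument is maximised under a bound on the value, and
  -- `Φ ≤ r` forces the argument to be at most `x₁`. The Slater point is `(Φ(0), 0)`.
  let A : Set (ℝ × ℝ) := {p | 0 ≤ p.2 ∧ Φ p.2.toNNReal ≤ (p.1 : EReal)}
  have hA : Convex ℝ A := by
    rintro ⟨s, x⟩ ⟨hx, hxs⟩ ⟨t, y⟩ ⟨hy, hyt⟩ a b ha hb hab
    exact ⟨add_nonneg (mul_nonneg ha hx) (mul_nonneg hb hy), h.combo_le hx hy hxs hyt ha hb hab⟩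
  obtain ⟨l, hl, hlA⟩ := exists_multiplier hA (t₀ := r) (S := x₁)
    (by
      rintro ⟨s, y⟩ ⟨hy, hys⟩ hs
      by_contra hcon
      have h1 : Φ x₁ ≤ Φ y.toNNReal := hΦ.mono (NNReal.le_toNNReal_of_coe_le (not_le.1 hcon).le)
      have h2 : Φ y.toNNReal ≤ (r : EReal) := hys.trans (EReal.coe_le_coe_iff.2 hs)
      exact absurd (hx₁r.trans_le (h1.trans h2)) (lt_irrefl _))
    (p₀ := (z, 0)) ⟨le_rfl, by simp [hz]⟩ hrz
  have hx : (x₁ : ℝ) < x₀ := hx₁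
  -- The multiplier may vanish, so the slope is `1/(l + e)`; this `e` spends exactly the gap `x₀ -
  -- x₁`, and `s ≥ z` then gives `h3`.
  set e : ℝ := (x₀ - x₁) / (r - z) with he
  have hepos : 0 < e := div_pos (by linarith) (by linarith)
  have hee : e * (r - z) = x₀ - x₁ := div_mul_cancel₀ _ (by linarith)
  refine ⟨NNReal.mk (l + e)⁻¹ (by positivity), (l + e)⁻¹ * x₀ - r,
    convexConjugate_le (hΦ.ne_bot h) fun y s hs => ?_, by simp⟩
  have h1 : (y : ℝ) ≤ x₁ + l * (s - r) := hlA (s, y) ⟨y.2, by simp [hs]⟩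
  have h2 := hzle y s hs
  have h3 : (y : ℝ) - x₀ ≤ (l + e) * (s - r) := by nlinarith
  have h4 : (l + e)⁻¹ * ((y : ℝ) - x₀) ≤ s - r := by
    rw [inv_mul_le_iff₀ (by positivity)]; exact h3
  rw [EReal.coe_le_coe_iff, NNReal.coe_mk]
  linarith

/-- The sequence starts with the horizontal minorant of height `Φ(0)`, as `exists_selection` needs a
zero slope at index 0. -/
lemma IsOrliczFunction.exists_seq_le_iSup (hΦ : IsOrliczFunction Φ) (h : IsConvexFn Φ) :
    ∃ p : ℕ → ℝ≥0 × ℝ, (p 0).1 = 0 ∧ (∀ n, convexConjugate Φ (p n).1 ≤ (p n).2) ∧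
      ∀ x : ℝ≥0, Φ x ≤ ⨆ n, ((((p n).1 : ℝ) * x - (p n).2 : ℝ) : EReal) := by
  obtain ⟨z, hz, hz1⟩ := hΦ.exists_zero_eq h
  have h0 : convexConjugate Φ (0 : ℝ≥0) ≤ ((-z : ℝ) : EReal) := by
    refine convexConjugate_le (hΦ.ne_bot h) fun x s hs => ?_
    have : Φ 0 ≤ Φ x := hΦ.mono zero_le
    rw [hz, hs, EReal.coe_le_coe_iff] at this
    rw [EReal.coe_le_coe_iff]
    simp; linarith
  obtain ⟨p, hp0, hpT, hp⟩ := exists_seq_affine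
    {p : ℝ≥0 × ℝ | convexConjugate Φ p.1 ≤ p.2} (p₀ := (0, -z)) h0
  refine ⟨p, by rw [hp0], hpT, fun x => EReal.ge_of_forall_gt_iff_ge.1 fun r hr => ?_⟩
  obtain ⟨a, b, hab, hrab⟩ := hΦ.exists_affine_minorant h hr
  exact (EReal.coe_le_coe_iff.2 hrab).trans (hp x (a, b) hab)

lemma IsOrliczFunction.exists_seq_convexConjugate_le_iSup (hΦ : IsOrliczFunction Φ)
    (h : IsConvexFn Φ) :
    ∃ p : ℕ → ℝ≥0 × ℝ, (p 0).1 = 0 ∧ (∀ n, Φ (p n).1 ≤ (p n).2) ∧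
      ∀ y : ℝ, convexConjugate Φ y ≤ ⨆ n, ((((p n).1 : ℝ) * y - (p n).2 : ℝ) : EReal) := by
  obtain ⟨z, hz, hz1⟩ := hΦ.exists_zero_eq h
  obtain ⟨p, hp0, hpT, hp⟩ := exists_seq_affine
    {p : ℝ≥0 × ℝ | Φ p.1 ≤ p.2} (p₀ := (0, z)) hz.le
  exact ⟨p, by rw [hp0], hpT, fun y => convexConjugate_le (hΦ.ne_bot h) fun x s hs =>
    hp y (x, s) hs.le⟩

end

/-! ### Weak and strong duality. -/

section

variable {Φ : ℝ≥0 → EReal} {Ω : Type*} [MeasurableSpace Ω] {P Q : Measure Ω}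

/-- The infimum of which `orliczPenalty` is the inverse. -/
noncomputable def penaltyInf (P : Measure Ω) (Φ : ℝ≥0 → EReal) (Q : Measure Ω) : EReal :=
  ⨅ t : {t : ℝ // 0 < t}, (((t : ℝ)⁻¹ : ℝ) : EReal) *
    eexpect P (fun ω => 1 + convexConjugate Φ ((t : ℝ) * (Q.rnDeriv P ω).toReal))

lemma orliczPenalty_eq_inv : orliczPenalty P Φ Q = (penaltyInf P Φ Q)⁻¹ := rfl

lemma penaltyInf_le {t c : ℝ} (ht : 0 < t)
    (h : eexpect P (fun ω => 1 + convexConjugate Φ (t * (Q.rnDeriv P ω).toReal)) ≤ c) :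
    penaltyInf P Φ Q ≤ ((t⁻¹ * c : ℝ) : EReal) := by
  refine (iInf_le _ ⟨t, ht⟩).trans ?_
  rw [EReal.coe_mul]
  exact mul_le_mul_of_nonneg_left h (by exact_mod_cast (inv_pos.2 ht).le)

lemma le_penaltyInf {c : ℝ} (h : ∀ t : ℝ, 0 < t → ((t * c : ℝ) : EReal) ≤
      eexpect P (fun ω => 1 + convexConjugate Φ (t * (Q.rnDeriv P ω).toReal))) :
    (c : EReal) ≤ penaltyInf P Φ Q := by
  refine le_iInf fun t => ?_
  have h1 := mul_le_mul_of_nonneg_left (h t t.2)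
    (show (0 : EReal) ≤ (((t : ℝ)⁻¹ : ℝ) : EReal) by exact_mod_cast (inv_pos.2 t.2).le)
  rwa [← EReal.coe_mul, inv_mul_cancel_left₀ t.2.ne'] at h1

lemma integrable_rnDeriv_mul [IsProbabilityMeasure Q] {X : Ω → ℝ} (hX : MemLp X ∞ P) :
    Integrable (fun ω => (Q.rnDeriv P ω).toReal * X ω) P :=
  Measure.integrable_toReal_rnDeriv.mul_of_top_left hX

lemma integral_rnDeriv_mul [IsProbabilityMeasure P] [IsProbabilityMeasure Q] (hQ : Q ≪ P)
    (X : Ω → ℝ) : ∫ ω, (Q.rnDeriv P ω).toReal * X ω ∂P = ∫ ω, X ω ∂Q := by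
  simpa using integral_rnDeriv_smul (f := X) hQ

lemma memLp_top_comp_nat {N : Ω → ℕ} (hN : Measurable N) {M : ℕ} (hM : ∀ ω, N ω ≤ M)
    (f : ℕ → ℝ) : MemLp (fun ω => f (N ω)) ∞ P :=
  memLp_top_of_bound ((measurable_from_nat (f := f)).comp hN).aestronglyMeasurable
    (∑ n ∈ Finset.range (M + 1), |f n|) (ae_of_all _ fun ω =>
      Finset.single_le_sum (f := fun n => |f n|) (fun _ _ => abs_nonneg _)
        (Finset.mem_range.2 (Nat.lt_succ_of_le (hM ω))))

lemma orliczPremium_eq (hΦ : IsOrliczFunction Φ) (hconv : IsConvexFn Φ) (X : Ω → ℝ) :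
    orliczPremium P Φ X =
      sInf {k : ℝ | 0 < k ∧ eexpect P (fun ω => Φ (X ω / k).toNNReal) ≤ 1} :=
  if_neg fun h => hΦ.ne_bot hconv 0 h.2

lemma orliczPremium_nonneg (hΦ : IsOrliczFunction Φ) (hconv : IsConvexFn Φ) (X : Ω → ℝ) :
    0 ≤ orliczPremium P Φ X := by
  rw [orliczPremium_eq hΦ hconv]
  exact Real.sInf_nonneg fun k hk => hk.1.le

lemma orliczPremium_le (hΦ : IsOrliczFunction Φ) (hconv : IsConvexFn Φ) {X : Ω → ℝ} {k : ℝ}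
    (hk : 0 < k) (h : eexpect P (fun ω => Φ (X ω / k).toNNReal) ≤ 1) :
    orliczPremium P Φ X ≤ k := by
  rw [orliczPremium_eq hΦ hconv]
  exact csInf_le ⟨0, fun k hk => hk.1.le⟩ ⟨hk, h⟩

variable [IsProbabilityMeasure P]

lemma one_le_penaltyInf (hΦ : IsOrliczFunction Φ) (hQ : Q ∈ absContProb P) :
    1 ≤ penaltyInf P Φ Q := by
  obtain ⟨hQp, hQa⟩ := hQ
  refine le_penaltyInf (c := 1) fun t ht => ?_
  have hi : Integrable (fun ω => t * (Q.rnDeriv P ω).toReal) P :=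
    Measure.integrable_toReal_rnDeriv.const_mul t
  have h1 : ∫ ω, t * (Q.rnDeriv P ω).toReal ∂P = t * 1 := by
    rw [integral_const_mul, Measure.integral_toReal_rnDeriv hQa]; simp
  rw [← h1]
  refine integral_le_eexpect hi (ae_of_all _ fun ω => ?_)
  have h2 := le_convexConjugate (Φ := Φ) (x := 1) (s := 1) (hΦ.le_one 1 le_rfl)
    (t * (Q.rnDeriv P ω).toReal)
  calc ((t * (Q.rnDeriv P ω).toReal : ℝ) : EReal)
      = 1 + ((((1 : ℝ≥0) : ℝ) * (t * (Q.rnDeriv P ω).toReal) - 1 : ℝ) : EReal) := by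
        rw [← EReal.coe_one, ← EReal.coe_add]; simp
    _ ≤ _ := by gcongr

/-- Weak duality. -/
lemma integral_div_le_penaltyInf (hΦ : IsOrliczFunction Φ) (hconv : IsConvexFn Φ)
    (hQ : Q ∈ absContProb P) {X : Ω → ℝ} (hX : X ∈ linftyPos P) {k : ℝ} (hk : 0 < k)
    (hle : eexpect P (fun ω => Φ (X ω / k).toNNReal) ≤ 1) :
    (((∫ ω, X ω ∂Q) / k : ℝ) : EReal) ≤ penaltyInf P Φ Q := by
  obtain ⟨hQp, hQa⟩ := hQ
  obtain ⟨hXb, hX0⟩ := hX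
  obtain ⟨z, hz, -⟩ := hΦ.exists_zero_eq hconv
  have hXm : AEMeasurable X P := hXb.1.aemeasurable
  -- An integrable majorant of `Φ(X/k)` lets Young's inequality be integrated in the reals.
  obtain ⟨b, hb, hfb, hb1⟩ := exists_integrable_of_eexpect_le (c := 1) (m := z)
    (hΦ.mono.measurable.comp_aemeasurable (hXm.div_const k).real_toNNReal)
    (fun ω => by rw [← hz]; exact hΦ.mono zero_le) hle
  refine le_penaltyInf fun t ht => ?_
  have hi : Integrable (fun ω => t / k * ((Q.rnDeriv P ω).toReal * X ω)) P :=
    (integrable_rnDeriv_mul hXb).const_mul _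
  have hi2 : Integrable (fun ω => t / k * ((Q.rnDeriv P ω).toReal * X ω) + (1 - b ω)) P :=
    hi.add ((integrable_const 1).sub hb)
  refine le_trans ?_ (integral_le_eexpect hi2 ?_)
  · have hi3 : Integrable (fun ω => 1 - b ω) P := (integrable_const 1).sub hb
    rw [integral_add hi hi3, integral_const_mul,
      integral_rnDeriv_mul hQa, integral_sub (integrable_const 1) hb, EReal.coe_le_coe_iff]
    have : t * ((∫ ω, X ω ∂Q) / k) = t / k * ∫ ω, X ω ∂Q := by ring
    simp only [integral_const, probReal_univ, smul_eq_mul, one_mul]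
    linarith
  · filter_upwards [hfb, hX0] with ω hω hω0
    have h2 := le_convexConjugate hω (t * (Q.rnDeriv P ω).toReal)
    rw [Real.coe_toNNReal _ (div_nonneg hω0 hk.le)] at h2
    calc ((t / k * ((Q.rnDeriv P ω).toReal * X ω) + (1 - b ω) : ℝ) : EReal)
        = 1 + ((X ω / k * (t * (Q.rnDeriv P ω).toReal) - b ω : ℝ) : EReal) := by
          rw [← EReal.coe_one, ← EReal.coe_add]
          congr 1; ring
      _ ≤ _ := by gcongr

/-- Strong duality for the Orlicz premium. -/
lemma exists_penaltyInf_le (hΦ : IsOrliczFunction Φ) (hconv : IsConvexFn Φ)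
    {X : Ω → ℝ} (hX : X ∈ linftyPos P) {k : ℝ} (hk : 0 < k)
    (hlt : 1 < eexpect P (fun ω => Φ (X ω / k).toNNReal)) :
    ∃ Q ∈ absContProb P, penaltyInf P Φ Q ≤ (((∫ ω, X ω ∂Q) / k : ℝ) : EReal) := by
  obtain ⟨hXb, hX0⟩ := hX
  obtain ⟨z, hz, hz1⟩ := hΦ.exists_zero_eq hconv
  have hXm : AEMeasurable X P := hXb.1.aemeasurable
  obtain ⟨p, hp0, hpT, hp⟩ := hΦ.exists_seq_le_iSup hconv
  -- A version of `X/k` that is measurable and nonnegative everywhere, since the selection works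
  -- pointwise.
  let Y : Ω → ℝ := fun ω => (hXm.mk X ω / k).toNNReal
  have hYm : Measurable Y := by
    have := hXm.measurable_mk
    fun_prop
  have hYX : ∀ᵐ ω ∂P, Y ω = X ω / k := by
    filter_upwards [hXm.ae_eq_mk, hX0] with ω h1 h2
    simp only [Y]
    rw [← h1, Real.coe_toNNReal _ (div_nonneg h2 hk.le)]
  have hXi : Integrable X P := hXb.integrable (by simp)
  have hY : Integrable Y P := (hXi.div_const k).congr (hYX.mono fun ω h => h.symm)
  have hlt' : ((1 : ℝ) : EReal) < eexpect P (fun ω => Φ (Y ω).toNNReal) := by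
    rw [eexpect_congr (g := fun ω => Φ (X ω / k).toNNReal) (hYX.mono fun ω h => by simp only [h])]
    exact hlt
  obtain ⟨N, hN, ⟨M, hM⟩, hsel⟩ := exists_selection hY hYm (a := fun n => (p n).1)
    (b := fun n => (p n).2) (by simp [hp0])
    (fun ω => by simpa [Y] using hp (Y ω).toNNReal) hlt'
  have hWb := memLp_top_comp_nat (P := P) hN hM fun n => ((p n).1 : ℝ)
  have hBb := memLp_top_comp_nat (P := P) hN hM fun n => (p n).2
  have hWi : Integrable (fun ω => ((p (N ω)).1 : ℝ)) P := hWb.integrable (by simp)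
  have hBi : Integrable (fun ω => (p (N ω)).2) P := hBb.integrable (by simp)
  have hWY : Integrable (fun ω => ((p (N ω)).1 : ℝ) * Y ω) P := hY.mul_of_top_right hWb
  rw [integral_sub hWY hBi] at hsel
  set l : ℝ := ∫ ω, ((p (N ω)).1 : ℝ) ∂P with hl
  have hl0 : 0 ≤ l := integral_nonneg fun ω => NNReal.coe_nonneg _
  -- If the slopes vanished a.e., the selection would give `1 < -E[B]`, while `B ≥ Ψ(W) ≥ W - 1 ≥
  -- -1`.
  have hlpos : 0 < l := by
    refine hl0.lt_of_ne fun h0 => ?_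
    have h1 : ∀ᵐ ω ∂P, ((p (N ω)).1 : ℝ) = 0 :=
      (integral_eq_zero_iff_of_nonneg (fun ω => NNReal.coe_nonneg _) hWi).1 h0.symm
    have h2 : ∫ ω, ((p (N ω)).1 : ℝ) * Y ω ∂P = 0 :=
      integral_eq_zero_of_ae (h1.mono fun ω h => by simp [h])
    have h3 : -1 ≤ ∫ ω, (p (N ω)).2 ∂P := by
      have : ∫ ω, (-1 : ℝ) ∂P = -1 := by simp
      rw [← this]
      refine integral_mono_ae (integrable_const _) hBi (ae_of_all _ fun ω => ?_)
      have h4 := (le_convexConjugate (hΦ.le_one 1 le_rfl) _).trans (hpT (N ω))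
      rw [EReal.coe_le_coe_iff, NNReal.coe_one, one_mul] at h4
      linarith [NNReal.coe_nonneg (p (N ω)).1]
    linarith
  -- The density is `W / E[W]`; at `t = l` the argument `t dQ/dP` is `W` itself, where `Ψ` is at
  -- most the selected intercept.
  let Z : Ω → ℝ≥0∞ := fun ω => ENNReal.ofReal ((p (N ω)).1 / l)
  have hZm : Measurable Z :=
    ((measurable_from_nat (f := fun n => ((p n).1 : ℝ) / l)).comp hN).ennreal_ofReal
  have hZr : ∀ ω, (Z ω).toReal = (p (N ω)).1 / l := fun ω =>
    ENNReal.toReal_ofReal (by positivity)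
  let Q : Measure Ω := P.withDensity Z
  have hQa : Q ≪ P := withDensity_absolutelyContinuous _ _
  have hQp : IsProbabilityMeasure Q := by
    refine ⟨?_⟩
    rw [withDensity_apply _ MeasurableSet.univ, setLIntegral_univ,
      ← ofReal_integral_eq_lintegral_ofReal (hWi.div_const l) (ae_of_all _ fun ω => by positivity),
      integral_div, ← hl, div_self hlpos.ne', ENNReal.ofReal_one]
  have hQX : (∫ ω, X ω ∂Q) / k = l⁻¹ * ∫ ω, ((p (N ω)).1 : ℝ) * Y ω ∂P := by
    rw [integral_withDensity_eq_integral_toReal_smul hZm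
      (ae_of_all _ fun ω => ENNReal.ofReal_lt_top), ← integral_div, ← integral_const_mul]
    refine integral_congr_ae (hYX.mono fun ω h => ?_)
    simp only [hZr, smul_eq_mul, h]
    ring
  refine ⟨Q, ⟨hQp, hQa⟩, ?_⟩
  have h1 : eexpect P (fun ω => 1 + convexConjugate Φ (l * (Q.rnDeriv P ω).toReal)) ≤
      ((∫ ω, (1 + (p (N ω)).2) ∂P : ℝ) : EReal) := by
    refine eexpect_le_integral ((integrable_const 1).add hBi) ?_
    filter_upwards [Measure.rnDeriv_withDensity P hZm] with ω hω
    rw [hω, hZr, mul_div_cancel₀ _ hlpos.ne', EReal.coe_add]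
    exact add_le_add le_rfl (hpT (N ω))
  refine (penaltyInf_le hlpos h1).trans (EReal.coe_le_coe_iff.2 ?_)
  rw [hQX, integral_add (integrable_const 1) hBi]
  refine mul_le_mul_of_nonneg_left ?_ (inv_pos.2 hlpos).le
  simp
  linarith

lemma le_orliczPremium (hΦ : IsOrliczFunction Φ) (hconv : IsConvexFn Φ) {X : Ω → ℝ}
    (hX : X ∈ linftyPos P) {c : ℝ}
    (h : ∀ k, 0 < k → eexpect P (fun ω => Φ (X ω / k).toNNReal) ≤ 1 → c ≤ k) :
    c ≤ orliczPremium P Φ X := by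
  rw [orliczPremium_eq hΦ hconv]
  refine le_csInf ?_ fun k hk => h k hk.1 hk.2
  -- The set must be nonempty for `le_csInf`; `ess sup |X| + 1` belongs to it and is positive even
  -- for `X = 0`.
  have hfin : eLpNormEssSup X P ≠ ⊤ := by simpa using hX.1.2.ne
  have hk : 0 < (eLpNormEssSup X P).toReal + 1 := by positivity
  refine ⟨(eLpNormEssSup X P).toReal + 1, hk, ?_⟩
  have h1 : eexpect P (fun ω => Φ (X ω / ((eLpNormEssSup X P).toReal + 1)).toNNReal) ≤
      ((∫ _, (1 : ℝ) ∂P : ℝ) : EReal) := by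
    refine eexpect_le_integral (integrable_const _) ?_
    filter_upwards [ae_le_eLpNormEssSup (f := X) (μ := P)] with ω hω
    refine hΦ.le_one _ ?_
    rw [Real.toNNReal_le_one, div_le_one hk]
    have h2 := ENNReal.toReal_mono hfin hω
    rw [toReal_enorm, Real.norm_eq_abs] at h2
    linarith [le_abs_self (X ω)]
  simpa using h1

/-- Lagrangian duality under the Slater condition `Φ 0 < 1`. -/
lemma penaltyInf_le_of_bound (hΦ : IsOrliczFunction Φ) (hconv : IsConvexFn Φ) (h0 : Φ 0 < 1)
    (hQ : Q ∈ absContProb P) {S : ℝ}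
    (hS : ∀ X ∈ acceptanceSet P (orliczPremium P Φ), ∫ ω, X ω ∂Q ≤ S) :
    penaltyInf P Φ Q ≤ S := by
  obtain ⟨hQp, hQa⟩ := hQ
  obtain ⟨z, hz, -⟩ := hΦ.exists_zero_eq hconv
  have hz1 : z < 1 := by rw [hz] at h0; exact_mod_cast h0
  -- Real majorants `b` of `Φ(X)` replace `E[Φ(X)]`, which keeps the set convex and free of infinite
  -- values.
  let A : Set (ℝ × ℝ) := {q | ∃ X b : Ω → ℝ, MemLp X ∞ P ∧ (∀ ω, 0 ≤ X ω) ∧ Integrable b P ∧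
    (∀ ω, Φ (X ω).toNNReal ≤ b ω) ∧ q = (∫ ω, b ω ∂P, ∫ ω, (Q.rnDeriv P ω).toReal * X ω ∂P)}
  have hA : Convex ℝ A := by
    rintro _ ⟨X, b, hX, hX0, hb, hXb, rfl⟩ _ ⟨Y, d, hY, hY0, hd, hYd, rfl⟩ s t hs ht hst
    refine ⟨fun ω => s * X ω + t * Y ω, fun ω => s * b ω + t * d ω,
      (hX.const_mul s).add (hY.const_mul t),
      fun ω => add_nonneg (mul_nonneg hs (hX0 ω)) (mul_nonneg ht (hY0 ω)),
      (hb.const_mul s).add (hd.const_mul t),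
      fun ω => hconv.combo_le (hX0 ω) (hY0 ω) (hXb ω) (hYd ω) hs ht hst, ?_⟩
    rw [integral_add (hb.const_mul s) (hd.const_mul t), integral_const_mul, integral_const_mul]
    have h1 : ∀ ω, (Q.rnDeriv P ω).toReal * (s * X ω + t * Y ω) =
        s * ((Q.rnDeriv P ω).toReal * X ω) + t * ((Q.rnDeriv P ω).toReal * Y ω) :=
      fun ω => by ring
    simp_rw [h1]
    rw [integral_add ((integrable_rnDeriv_mul hX).const_mul s)
      ((integrable_rnDeriv_mul hY).const_mul t), integral_const_mul, integral_const_mul]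
    rfl
  obtain ⟨l, hl, hlA⟩ := exists_multiplier hA (t₀ := 1) (S := S)
    (by
      rintro _ ⟨X, b, hX, hX0, hb, hXb, rfl⟩ hb1
      simp only at hb1
      rw [integral_rnDeriv_mul hQa]
      refine hS X ⟨⟨hX, ae_of_all _ hX0⟩, orliczPremium_le hΦ hconv one_pos ?_⟩
      simp only [div_one]
      exact (eexpect_le_integral hb (ae_of_all _ hXb)).trans (EReal.coe_le_coe_iff.2 hb1))
    (p₀ := (z, 0)) ⟨fun _ => 0, fun _ => z, memLp_const 0, fun _ => le_rfl, integrable_const z,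
      fun _ => by simp [hz], by simp⟩ hz1
  -- `t = 1/l` is unavailable when `l = 0`, hence `l + e`. Because `E[b] ≥ z`, the perturbation
  -- costs at most `e(1 - z)`.
  have key : ∀ e : ℝ, 0 < e → penaltyInf P Φ Q ≤ ((S + e * (1 - z) : ℝ) : EReal) := by
    intro e he
    have hle : 0 < l + e := by linarith
    have h1 : eexpect P (fun ω => 1 + convexConjugate Φ ((l + e)⁻¹ * (Q.rnDeriv P ω).toReal)) ≤
        (((l + e)⁻¹ * (S + e * (1 - z)) : ℝ) : EReal) := by
      -- Otherwise a selection from the affine functions defining `Ψ` provides a bounded `X` and a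
      -- majorant `b` violating the multiplier inequality.
      by_contra hcon
      obtain ⟨p, hp0, hpT, hp⟩ := hΦ.exists_seq_convexConjugate_le_iSup hconv
      let Y : Ω → ℝ := fun ω => (l + e)⁻¹ * (Q.rnDeriv P ω).toReal
      have hY : Integrable Y P := Measure.integrable_toReal_rnDeriv.const_mul _
      have hYm : Measurable Y := (Measure.measurable_rnDeriv Q P).ennreal_toReal.const_mul _
      obtain ⟨N, hN, ⟨M, hM⟩, hsel⟩ := exists_selection hY hYm (a := fun n => (p n).1)
        (b := fun n => (p n).2 - 1) (by simp [hp0])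
        (fun ω => by
          rw [add_comm, ← EReal.le_sub_iff_add_le (by left; exact EReal.coe_ne_bot 1)
            (by left; exact EReal.coe_ne_top 1)]
          refine (hp (Y ω)).trans (iSup_le fun n => ?_)
          rw [EReal.le_sub_iff_add_le (by left; exact EReal.coe_ne_bot 1)
            (by left; exact EReal.coe_ne_top 1)]
          refine le_trans (le_of_eq ?_) (le_iSup _ n)
          rw [← EReal.coe_one, ← EReal.coe_add]
          congr 1; ring) (not_le.1 hcon)
      have hX := memLp_top_comp_nat (P := P) hN hM fun n => ((p n).1 : ℝ)
      have hb : Integrable (fun ω => (p (N ω)).2) P :=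
        (memLp_top_comp_nat (P := P) hN hM fun n => (p n).2).integrable (by simp)
      have h2 := hlA _ ⟨_, _, hX, fun ω => NNReal.coe_nonneg _, hb,
        fun ω => by simpa using hpT (N ω), rfl⟩
      have h3 : z ≤ ∫ ω, (p (N ω)).2 ∂P := by
        have h4 : ∫ ω, z ∂P = z := by simp
        rw [← h4]
        refine integral_mono_ae (integrable_const _) hb (ae_of_all _ fun ω => ?_)
        have h5 : Φ 0 ≤ (p (N ω)).2 := (hΦ.mono zero_le).trans (hpT (N ω))
        rw [hz] at h5
        exact_mod_cast h5
      have h6 : ∫ ω, ((p (N ω)).1 * Y ω - ((p (N ω)).2 - 1)) ∂P =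
          (l + e)⁻¹ * (∫ ω, (Q.rnDeriv P ω).toReal * (p (N ω)).1 ∂P) -
            (∫ ω, (p (N ω)).2 ∂P - 1) := by
        have h7 : ∀ ω, ((p (N ω)).1 : ℝ) * Y ω - ((p (N ω)).2 - 1) =
            (l + e)⁻¹ * ((Q.rnDeriv P ω).toReal * (p (N ω)).1) - ((p (N ω)).2 - 1) :=
          fun ω => by simp only [Y]; ring
        simp_rw [h7]
        have hb' : Integrable (fun ω => (p (N ω)).2 - 1) P := hb.sub (integrable_const 1)
        rw [integral_sub ((integrable_rnDeriv_mul hX).const_mul _) hb',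
          integral_const_mul, integral_sub hb (integrable_const 1)]
        simp
      rw [h6, ← mul_lt_mul_iff_right₀ hle, mul_inv_cancel_left₀ hle.ne',
        mul_sub (l + e) ((l + e)⁻¹ * _), mul_inv_cancel_left₀ hle.ne'] at hsel
      simp only at h2
      nlinarith
    have h2 := penaltyInf_le (inv_pos.2 hle) h1
    rwa [inv_inv, mul_inv_cancel_left₀ hle.ne'] at h2
  refine EReal.le_of_forall_lt_iff_le.1 fun c hc => ?_
  rw [EReal.coe_lt_coe_iff] at hc
  have h1 := key ((c - S) / (1 - z)) (div_pos (by linarith) (by linarith))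
  rwa [div_mul_cancel₀ _ (by linarith), add_sub_cancel] at h1

end

/-! ### From the infimum to its inverse, and the two formulas. -/

section

lemma inv_mul_le_of_div_le {c : EReal} (hc : 1 ≤ c) {x y : ℝ} (hy : 0 < y)
    (h : ((x / y : ℝ) : EReal) ≤ c) : c⁻¹ * x ≤ y := by
  induction c with
  | bot => exact absurd (le_bot_iff.1 hc) (EReal.coe_ne_bot 1)
  | top => simpa using hy.le
  | coe c =>
    have hc : (1 : ℝ) ≤ c := by exact_mod_cast hc
    rw [EReal.coe_le_coe_iff, div_le_iff₀ hy] at h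
    rw [← EReal.coe_inv, ← EReal.coe_mul, EReal.coe_le_coe_iff, inv_mul_le_iff₀ (by linarith)]
    exact h

lemma le_inv_mul_of_le_div {c : EReal} (hc : 1 ≤ c) {x y : ℝ} (hy : 0 < y)
    (h : c ≤ ((x / y : ℝ) : EReal)) : (y : EReal) ≤ c⁻¹ * x := by
  induction c with
  | bot => exact absurd (le_bot_iff.1 hc) (EReal.coe_ne_bot 1)
  | top => simp at h
  | coe c =>
    have hc : (1 : ℝ) ≤ c := by exact_mod_cast hc
    rw [EReal.coe_le_coe_iff, le_div_iff₀ hy] at h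
    rw [← EReal.coe_inv, ← EReal.coe_mul, EReal.coe_le_coe_iff, le_inv_mul_iff₀ (by linarith)]
    exact h

lemma inv_le_one_of_one_le {c : EReal} (hc : 1 ≤ c) : c⁻¹ ≤ 1 := by
  have := inv_mul_le_of_div_le hc (x := 1) one_pos (by simpa using hc)
  simpa using this

variable {Φ : ℝ≥0 → EReal} {Ω : Type*} [MeasurableSpace Ω] {P Q : Measure Ω}

lemma integral_nonneg_of_mem (hQ : Q ∈ absContProb P) {X : Ω → ℝ} (hX : X ∈ linftyPos P) :
    0 ≤ ∫ ω, X ω ∂Q :=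
  integral_nonneg_of_ae (hQ.2.ae_le hX.2)

variable [IsProbabilityMeasure P]

lemma orliczPenalty_mul_le (hΦ : IsOrliczFunction Φ) (hconv : IsConvexFn Φ)
    (hQ : Q ∈ absContProb P) {X : Ω → ℝ} (hX : X ∈ linftyPos P) :
    orliczPenalty P Φ Q * ((∫ ω, X ω ∂Q : ℝ) : EReal) ≤ (orliczPremium P Φ X : ℝ) := by
  refine EReal.ge_of_forall_gt_iff_ge.1 fun r hr => ?_
  rw [EReal.coe_le_coe_iff]
  refine le_orliczPremium hΦ hconv hX fun k hk hle => ?_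
  rw [← EReal.coe_le_coe_iff]
  exact hr.le.trans (inv_mul_le_of_div_le (one_le_penaltyInf hΦ hQ) hk
    (integral_div_le_penaltyInf hΦ hconv hQ hX hk hle))

/-- Membership only bounds an infimum over `k` by 1, and `k = 1` is not known to be admissible;
inverting `orliczPenalty_mul_le` avoids proving attainment. -/
lemma integral_le_penaltyInf (hΦ : IsOrliczFunction Φ) (hconv : IsConvexFn Φ)
    (hQ : Q ∈ absContProb P) {X : Ω → ℝ} (hX : X ∈ acceptanceSet P (orliczPremium P Φ)) :
    ((∫ ω, X ω ∂Q : ℝ) : EReal) ≤ penaltyInf P Φ Q := by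
  have h1 : orliczPenalty P Φ Q * ((∫ ω, X ω ∂Q : ℝ) : EReal) ≤ 1 :=
    (orliczPenalty_mul_le hΦ hconv hQ hX.1).trans (by exact_mod_cast hX.2)
  have hc := one_le_penaltyInf hΦ hQ
  rw [orliczPenalty_eq_inv] at h1
  generalize penaltyInf P Φ Q = c at h1 hc
  induction c with
  | bot => exact absurd (le_bot_iff.1 hc) (EReal.coe_ne_bot 1)
  | top => exact le_top
  | coe c =>
    have hc : (1 : ℝ) ≤ c := by exact_mod_cast hc
    rw [← EReal.coe_inv, ← EReal.coe_mul, ← EReal.coe_one, EReal.coe_le_coe_iff,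
      inv_mul_le_iff₀ (by linarith), mul_one] at h1
    exact_mod_cast h1

lemma self_mem_absContProb : P ∈ absContProb P :=
  ⟨inferInstance, Measure.AbsolutelyContinuous.rfl⟩

lemma orliczPremium_eq_iSup (hΦ : IsOrliczFunction Φ) (hconv : IsConvexFn Φ) {X : Ω → ℝ}
    (hX : X ∈ linftyPos P) :
    ((orliczPremium P Φ X : ℝ) : EReal) =
      ⨆ Q ∈ absContProb P, orliczPenalty P Φ Q * ((∫ ω, X ω ∂Q : ℝ) : EReal) := by
  refine le_antisymm (EReal.ge_of_forall_gt_iff_ge.1 fun k hk => ?_)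
    (iSup₂_le fun Q hQ => orliczPenalty_mul_le hΦ hconv hQ hX)
  -- For `k ≤ 0` any nonnegative term suffices, and `Q = P` supplies one; strong duality needs `k >
  -- 0`.
  rcases le_or_gt k 0 with hk0 | hk0
  · refine le_trans ?_ (le_iSup₂ P self_mem_absContProb)
    exact le_trans (b := 0) (by exact_mod_cast hk0)
      (mul_nonneg (EReal.inv_nonneg_of_nonneg
        (zero_le_one.trans (one_le_penaltyInf hΦ self_mem_absContProb)))
        (by exact_mod_cast integral_nonneg_of_mem self_mem_absContProb hX))
  · have hlt : 1 < eexpect P (fun ω => Φ (X ω / k).toNNReal) := by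
      by_contra hcon
      have := orliczPremium_le hΦ hconv hk0 (not_lt.1 hcon)
      rw [EReal.coe_lt_coe_iff] at hk
      linarith
    obtain ⟨Q, hQ, hle⟩ := exists_penaltyInf_le hΦ hconv hX hk0 hlt
    exact (le_inv_mul_of_le_div (one_le_penaltyInf hΦ hQ) hk0 hle).trans
      (le_iSup₂ (f := fun Q (_ : Q ∈ absContProb P) =>
        orliczPenalty P Φ Q * ((∫ ω, X ω ∂Q : ℝ) : EReal)) Q hQ)

lemma iSup_acceptanceSet_eq (hΦ : IsOrliczFunction Φ) (hconv : IsConvexFn Φ) (h0 : Φ 0 < 1)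
    (hQ : Q ∈ absContProb P) :
    ⨆ X ∈ acceptanceSet P (orliczPremium P Φ), ((∫ ω, X ω ∂Q : ℝ) : EReal) =
      penaltyInf P Φ Q := by
  refine le_antisymm (iSup₂_le fun X hX => integral_le_penaltyInf hΦ hconv hQ hX)
    (EReal.le_of_forall_lt_iff_le.1 fun S hS => ?_)
  refine penaltyInf_le_of_bound hΦ hconv h0 hQ fun X hX => ?_
  rw [← EReal.coe_le_coe_iff]
  exact (le_iSup₂ (f := fun X (_ : X ∈ acceptanceSet P (orliczPremium P Φ)) =>
    ((∫ ω, X ω ∂Q : ℝ) : EReal)) X hX).trans hS.le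

end

end OrliczDual

theorem mainTheorem7 {Ω : Type*} [MeasurableSpace Ω] (P : Measure Ω) [IsProbabilityMeasure P]
    (Φ : ℝ≥0 → EReal) (hΦ : OrliczDual.IsOrliczFunction Φ) (hconv : OrliczDual.IsConvexFn Φ) :
    (∀ Q ∈ OrliczDual.absContProb P,
      0 ≤ OrliczDual.orliczPenalty P Φ Q ∧ OrliczDual.orliczPenalty P Φ Q ≤ 1) ∧
    (∀ X ∈ OrliczDual.linftyPos P,
      ((OrliczDual.orliczPremium P Φ X : ℝ) : EReal) =
        ⨆ Q ∈ OrliczDual.absContProb P,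
          OrliczDual.orliczPenalty P Φ Q * ((∫ ω, X ω ∂Q : ℝ) : EReal)) ∧
    (Φ 0 < 1 → ∀ Q ∈ OrliczDual.absContProb P,
      OrliczDual.riskPenalty P (OrliczDual.orliczPremium P Φ) Q =
        OrliczDual.orliczPenalty P Φ Q) := by
  refine ⟨fun Q hQ => ?_, fun X hX => OrliczDual.orliczPremium_eq_iSup hΦ hconv hX,
    fun h0 Q hQ => ?_⟩
  · have h1 := OrliczDual.one_le_penaltyInf hΦ hQ
    exact ⟨EReal.inv_nonneg_of_nonneg (zero_le_one.trans h1), OrliczDual.inv_le_one_of_one_le h1⟩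
  · rw [OrliczDual.riskPenalty, OrliczDual.iSup_acceptanceSet_eq hΦ hconv h0 hQ,
      OrliczDual.orliczPenalty_eq_inv]
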